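/- Let $\Omega\subset\mathbb{R}^d$ ($d\ge 1$) be convex and compact with non-empty interior, let $m>d/2$ be real, and let $\mathcal H$ be a reproducing kernel Hilbert space of continuous real functions on $\Omega$, with kernel $K$, that is equal to the (fractional) Sobolev space $H^m(\Omega)$ with equivalent norms. Write $\|v\|_{L_2}$ for the norm of $L_2(\Omega)$ and, given points $x_1,\dots,x_n\in\Omega$, $\|v\|_n^2=\frac1n\sum_{i=1}^n v(x_i)^2$. For each $n\ge1$ let $y_i=f(x_i)+e_i$, $i=1,\dots,n$, where the errors $E=(e_1,\dots,e_n)$ are independent and identically distributed with mean zero and finite variance, and where the design points $X=(x_1,\dots,x_n)\in\Omega^n$ (which may change with $n$) are deterministic, or random and independent of $E$. For a deterministic $\lambda=\lambda_n>0$ let $$\hat f=\operatorname*{argmin}_{v\in\mathcal H}\ \frac1n\sum_{i=1}^n (y_i-v(x_i))^2+\lambda\|v\|_{\mathcal H}^2$$ be the kernel ridge regression estimator. For $g\in\mathcal H$ let $\operatorname{BIAS}=\mathbb E_E\langle \hat f-f,g\rangle_{\mathcal H}$, where $\mathbb E_E$ is the expectation over $E$ with $X$ held fixed. Assume: 1.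 $g\in\mathcal H$ does not depend on $n$, and there are $C_g>0$ and $\delta\in(0,1]$ with $|\langle g,v\rangle_{\mathcal H}|\le C_g\|v\|_{L_2}^{\delta}\|v\|_{\mathcal H}^{1-\delta}$ for all $v\in\mathcal H$. 2. There is $C_1>0$, and for each $\epsilon>0$ there is $C_\epsilon>0$, all independent of $n$ and $X$, such that for every $n\ge 1$, with probability at least $1-\epsilon$, the inequalities $$\|v\|_{L_2}\le\max\{C_1\|v\|_n,\,C_\epsilon n^{-m/d}\|v\|_{\mathcal H}\},\qquad \|v\|_n\le\max\{C_1\|v\|_{L_2},\,C_\epsilon n^{-m/d}\|v\|_{\mathcal H}\}$$ hold simultaneously for all $v\in\mathcal H$. 3. $n^{-2m/d}=O(\lambda_n)$ and $\lambda_n\to0$ as $n\to\infty$. 4. $f\in\mathcal H$ does not depend on $n$. Then $|\operatorname{BIAS}|=o_{\mathbb P}(\lambda^{\delta/2})$, that is, $|\operatorname{BIAS}|/\lambda_n^{\delta/2}\to0$ in probability as $n\to\infty$. -/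

import Mathlib

open MeasureTheory ProbabilityTheory Filter Topology Asymptotics
open scoped ENNReal InnerProductSpace

noncomputable section

namespace KRRBias

/-! ### Sobolev spaces on an open subset of Euclidean space -/

/-- The classical partial derivative `D^α φ` for a multi-index `α`. -/
def partialDeriv {d : ℕ} (α : Fin d → ℕ) (φ : EuclideanSpace ℝ (Fin d) → ℝ) :
    EuclideanSpace ℝ (Fin d) → ℝ :=
  (List.finRange d).foldr
    (fun i ψ => (fun χ x => fderiv ℝ χ x (EuclideanSpace.single i 1))^[α i] ψ) φ

/-- `w` is a weak derivative `D^α u` on the open set `U`. -/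
def HasWeakDeriv {d : ℕ} (U : Set (EuclideanSpace ℝ (Fin d))) (α : Fin d → ℕ)
    (u w : EuclideanSpace ℝ (Fin d) → ℝ) : Prop :=
  LocallyIntegrableOn u U ∧ LocallyIntegrableOn w U ∧
    ∀ φ : EuclideanSpace ℝ (Fin d) → ℝ, ContDiff ℝ (⊤ : ℕ∞) φ → HasCompactSupport φ → tsupport φ ⊆ U →
      ∫ x in U, u x * partialDeriv α φ x = (-1) ^ (∑ i, α i) * ∫ x in U, w x * φ x

open Classical in
/-- The weak derivative `D^α u` on `U` (unique up to null sets when it exists; zero otherwise). -/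
def weakDeriv {d : ℕ} (U : Set (EuclideanSpace ℝ (Fin d))) (α : Fin d → ℕ)
    (u : EuclideanSpace ℝ (Fin d) → ℝ) : EuclideanSpace ℝ (Fin d) → ℝ :=
  if h : ∃ w, HasWeakDeriv U α u w then h.choose else 0

/-- The square of the norm of `H^k(U)`, for an integer order `k`. -/
def intSobolevNormSq {d : ℕ} (k : ℕ) (U : Set (EuclideanSpace ℝ (Fin d)))
    (u : EuclideanSpace ℝ (Fin d) → ℝ) : ℝ≥0∞ :=
  ∑ j ∈ Finset.range (k + 1), ∑ α ∈ Finset.piAntidiag (Finset.univ : Finset (Fin d)) j,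
    ∫⁻ x in U, ‖weakDeriv U α u x‖ₑ ^ 2

/-- The square of the Sobolev–Slobodeckij semi-norm of order `k + s`, for `0 < s < 1`. -/
def slobodeckijSeminormSq {d : ℕ} (k : ℕ) (s : ℝ) (U : Set (EuclideanSpace ℝ (Fin d)))
    (u : EuclideanSpace ℝ (Fin d) → ℝ) : ℝ≥0∞ :=
  ∑ α ∈ Finset.piAntidiag (Finset.univ : Finset (Fin d)) k,
    ∫⁻ x in U, ∫⁻ y in U,
      ‖weakDeriv U α u x - weakDeriv U α u y‖ₑ ^ 2 / edist x y ^ ((d : ℝ) + 2 * s)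

open Classical in
/-- The square of the norm of `H^m(U)`, for a real order `m ≥ 0`. -/
def sobolevNormSq {d : ℕ} (m : ℝ) (U : Set (EuclideanSpace ℝ (Fin d)))
    (u : EuclideanSpace ℝ (Fin d) → ℝ) : ℝ≥0∞ :=
  intSobolevNormSq ⌊m⌋₊ U u +
    if m = ⌊m⌋₊ then 0 else slobodeckijSeminormSq ⌊m⌋₊ (m - ⌊m⌋₊) U u

/-- Membership in the (fractional) Sobolev space `H^m(U)`. -/
def MemSobolev {d : ℕ} (m : ℝ) (U : Set (EuclideanSpace ℝ (Fin d)))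
    (u : EuclideanSpace ℝ (Fin d) → ℝ) : Prop :=
  (∀ α : Fin d → ℕ, ∑ i, α i ≤ ⌊m⌋₊ → ∃ w, HasWeakDeriv U α u w) ∧ sobolevNormSq m U u < ⊤

/-- The norm of `H^m(U)`. -/
def sobolevNorm {d : ℕ} (m : ℝ) (U : Set (EuclideanSpace ℝ (Fin d)))
    (u : EuclideanSpace ℝ (Fin d) → ℝ) : ℝ :=
  √(sobolevNormSq m U u).toReal

/-! ### Reproducing kernel Hilbert spaces of functions on a set `Ω` -/

/-- The extension by zero of a function on `Ω`. -/
def zeroExt {d : ℕ} {Ω : Set (EuclideanSpace ℝ (Fin d))} (v : Ω → ℝ) :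
    EuclideanSpace ℝ (Fin d) → ℝ :=
  Function.extend Subtype.val v 0

/-- The reproducing kernel Hilbert space `H` of functions on `Ω` consists of continuous functions
and is equal to `H^m` with equivalent norms: a function on the interior of `Ω` is in `H^m` if and
only if it is almost everywhere equal to an element of `H`. -/
structure IsSobolevRKHS {d : ℕ} (m : ℝ) (Ω : Set (EuclideanSpace ℝ (Fin d)))
    (H : Type*) [NormedAddCommGroup H] [InnerProductSpace ℝ H] [RKHS ℝ H Ω ℝ] : Prop where
  continuous : ∀ v : H, Continuous (v : Ω → ℝ)
  memSobolev_iff : ∀ u : EuclideanSpace ℝ (Fin d) → ℝ,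
    MemSobolev m (interior Ω) u ↔
      ∃ v : H, u =ᵐ[volume.restrict (interior Ω)] zeroExt (v : Ω → ℝ)
  norm_equiv : ∃ c C : ℝ, 0 < c ∧ 0 < C ∧ ∀ v : H,
    c * ‖v‖ ≤ sobolevNorm m (interior Ω) (zeroExt (v : Ω → ℝ)) ∧
      sobolevNorm m (interior Ω) (zeroExt (v : Ω → ℝ)) ≤ C * ‖v‖

/-- The norm of `L₂(Ω)`. -/
def l2Norm {d : ℕ} {Ω : Set (EuclideanSpace ℝ (Fin d))} (v : Ω → ℝ) : ℝ :=
  √(∫ x in Ω, zeroExt v x ^ 2)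

/-- The empirical norm `‖v‖ₙ` at the design points `x₁, …, xₙ`. -/
def empNorm {X : Type*} {n : ℕ} (x : Fin n → X) (v : X → ℝ) : ℝ :=
  √((1 / (n : ℝ)) * ∑ i, v (x i) ^ 2)

/-- The interpolation-type smoothness of `g` with exponent `δ`:
`|⟨g, v⟩| ≤ C_g ‖v‖_{L₂}^δ ‖v‖_H^{1-δ}` for all `v`. -/
def HasExtraSmoothness {d : ℕ} {Ω : Set (EuclideanSpace ℝ (Fin d))} {H : Type*}
    [NormedAddCommGroup H] [InnerProductSpace ℝ H] [RKHS ℝ H Ω ℝ] (δ : ℝ) (g : H) : Prop :=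
  ∃ Cg : ℝ, 0 < Cg ∧ ∀ v : H, |⟪g, v⟫_ℝ| ≤ Cg * l2Norm (v : Ω → ℝ) ^ δ * ‖v‖ ^ (1 - δ)

/-- The set of designs `x` for which the `L₂` norm and the empirical norm are comparable on `H`
with the constants `C₁` and `C_ε`. -/
def goodDesigns {d : ℕ} {Ω : Set (EuclideanSpace ℝ (Fin d))} (H : Type*)
    [NormedAddCommGroup H] [InnerProductSpace ℝ H] [RKHS ℝ H Ω ℝ]
    (m C₁ Cε : ℝ) (n : ℕ) : Set (Fin n → Ω) :=
  {x | ∀ v : H,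
    l2Norm (v : Ω → ℝ) ≤ max (C₁ * empNorm x v) (Cε * (n : ℝ) ^ (-(m / d)) * ‖v‖) ∧
    empNorm x v ≤ max (C₁ * l2Norm (v : Ω → ℝ)) (Cε * (n : ℝ) ^ (-(m / d)) * ‖v‖)}

/-- With probability at least `1 - ε` the `n`-th design is good with constants `C₁` and `C_ε`,
where `C₁` depends neither on `ε` nor on `n`, and `C_ε` does not depend on `n`. -/
def DesignCondition {d : ℕ} {Ω : Set (EuclideanSpace ℝ (Fin d))} (H : Type*)
    [NormedAddCommGroup H] [InnerProductSpace ℝ H] [RKHS ℝ H Ω ℝ] (m : ℝ)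
    {S : Type*} [MeasurableSpace S] (P : Measure S) (X : (n : ℕ) → Fin n → S → Ω) : Prop :=
  ∃ C₁ : ℝ, 0 < C₁ ∧ ∀ ε : ℝ, 0 < ε → ∃ Cε : ℝ, 0 < Cε ∧ ∀ n : ℕ, 1 ≤ n →
    P {ω | (fun i => X n i ω) ∉ goodDesigns H m C₁ Cε n} ≤ ENNReal.ofReal ε

/-! ### Kernel ridge regression -/

section KRR

variable {X H : Type*} [NormedAddCommGroup H] [InnerProductSpace ℝ H] [RKHS ℝ H X ℝ]

/-- The kernel ridge regression criterion. -/
def krrObjective {n : ℕ} (lam : ℝ) (x : Fin n → X) (y : Fin n → ℝ) (v : H) : ℝ :=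
  (1 / (n : ℝ)) * ∑ i, (y i - v (x i)) ^ 2 + lam * ‖v‖ ^ 2

/-- The kernel ridge regression estimator: the minimizer of the criterion over `H`. -/
def krr (H : Type*) [NormedAddCommGroup H] [InnerProductSpace ℝ H] [RKHS ℝ H X ℝ]
    {n : ℕ} (lam : ℝ) (x : Fin n → X) (y : Fin n → ℝ) : H :=
  Classical.epsilon fun v : H => IsMinOn (krrObjective lam x y) Set.univ v

/-- The bias `𝔼_E ⟨f̂ - f, g⟩` for the data `y i = f (x i) + e i`: the expectation over the errors
`e` with the design `x` held fixed. -/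
def bias {S : Type*} [MeasurableSpace S] (P : Measure S) {n : ℕ} (lam : ℝ) (x : Fin n → X)
    (e : Fin n → S → ℝ) (f g : H) : ℝ :=
  ∫ ω, ⟪krr H lam x (fun i => f (x i) + e i ω) - f, g⟫_ℝ ∂P

/-! The estimator and the bias are well defined. -/

variable [CompleteSpace H]

/-- The kernel matrix `K(x, x)`. -/
def kernelMatrix (H : Type*) [NormedAddCommGroup H] [InnerProductSpace ℝ H] [RKHS ℝ H X ℝ]
    [CompleteSpace H] {n : ℕ} (x : Fin n → X) : Matrix (Fin n) (Fin n) ℝ :=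
  Matrix.of fun i j => RKHS.kernel H (x i) (x j) 1

/-- The representer formula `K(·, x) (K(x, x) + λ n I)⁻¹ y`. -/
def representer (H : Type*) [NormedAddCommGroup H] [InnerProductSpace ℝ H] [RKHS ℝ H X ℝ]
    [CompleteSpace H] {n : ℕ} (lam : ℝ) (x : Fin n → X) (y : Fin n → ℝ) : H :=
  ∑ i, ((kernelMatrix H x + (lam * n) • (1 : Matrix (Fin n) (Fin n) ℝ))⁻¹.mulVec y) i •
    RKHS.kerFun H (x i) 1

lemma kernelMatrix_add_mulVec_inv {n : ℕ} {lam : ℝ} (hn : 1 ≤ n) (hlam : 0 < lam)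
    (x : Fin n → X) (y : Fin n → ℝ) :
    (kernelMatrix H x + (lam * n) • (1 : Matrix (Fin n) (Fin n) ℝ)).mulVec
      ((kernelMatrix H x + (lam * n) • (1 : Matrix (Fin n) (Fin n) ℝ))⁻¹.mulVec y) = y := by
  have hgram : kernelMatrix H x = Matrix.gram ℝ (fun i => RKHS.kerFun H (x i) (1 : ℝ)) := by
    ext i j
    have h := RKHS.kernel_inner H (x j) (x i) (1 : ℝ) (1 : ℝ)
    have h' := RKHS.kerFun_inner (x i) (1 : ℝ) (RKHS.kerFun H (x j) (1 : ℝ))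
    rw [RKHS.kerFun_apply] at h'
    simp only [Matrix.gram_apply, kernelMatrix, Matrix.of_apply]
    rw [h']
    simp
  have hpos : (kernelMatrix H x + (lam * n) • (1 : Matrix (Fin n) (Fin n) ℝ)).PosDef := by
    rw [hgram]
    refine Matrix.PosDef.posSemidef_add (Matrix.posSemidef_gram _ _) ?_
    exact Matrix.PosDef.one.smul (by positivity)
  rw [Matrix.mulVec_mulVec, Matrix.mul_nonsing_inv _ ((Matrix.isUnit_iff_isUnit_det _).1 hpos.isUnit),
    Matrix.one_mulVec]

lemma krrObjective_eq {n : ℕ} {lam : ℝ} (hn : 1 ≤ n) (hlam : 0 < lam)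
    (x : Fin n → X) (y : Fin n → ℝ) (v : H) :
    krrObjective lam x y v = krrObjective lam x y (representer H lam x y) +
      ((1 / (n : ℝ)) * ∑ i, ((v - representer H lam x y : H) (x i)) ^ 2 +
        lam * ‖v - representer H lam x y‖ ^ 2) := by
  have hn' : (n : ℝ) ≠ 0 := by positivity
  set r : H := representer H lam x y with hr
  obtain ⟨h, rfl⟩ : ∃ h : H, v = r + h := ⟨v - r, by simp⟩
  set u := (kernelMatrix H x + (lam * n) • (1 : Matrix (Fin n) (Fin n) ℝ))⁻¹.mulVec y with hu
  have hres : ∀ i, y i - r (x i) = lam * n * u i := by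
    intro i
    have h1 := congrFun (kernelMatrix_add_mulVec_inv (H := H) hn hlam x y) i
    rw [← hu, Matrix.add_mulVec, Matrix.smul_mulVec, Matrix.one_mulVec] at h1
    have h2 : r (x i) = (kernelMatrix H x).mulVec u i := by
      have h3 : r (x i) = ⟪RKHS.kerFun H (x i) (1 : ℝ), r⟫_ℝ := by
        rw [RKHS.kerFun_inner]; simp
      rw [h3, hr, representer, ← hu, inner_sum]
      simp only [Matrix.mulVec, dotProduct, kernelMatrix, Matrix.of_apply]
      refine Finset.sum_congr rfl fun j _ => ?_
      rw [inner_smul_right, RKHS.kerFun_inner, RKHS.kerFun_apply]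
      simp [mul_comm]
    simp only [Pi.add_apply, Pi.smul_apply, smul_eq_mul] at h1
    rw [h2]
    linarith
  have hin : ⟪r, h⟫_ℝ = ∑ i, u i * h (x i) := by
    rw [hr, representer, ← hu, sum_inner]
    refine Finset.sum_congr rfl fun j _ => ?_
    rw [inner_smul_left, RKHS.kerFun_inner]
    simp
  have hsum : ∑ i, (y i - (r + h : H) (x i)) ^ 2 =
      ∑ i, (y i - r (x i)) ^ 2 - 2 * (lam * n) * (∑ i, u i * h (x i)) + ∑ i, (h (x i)) ^ 2 := by
    rw [Finset.mul_sum, ← Finset.sum_sub_distrib, ← Finset.sum_add_distrib]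
    refine Finset.sum_congr rfl fun i _ => ?_
    have h4 := hres i
    rw [RKHS.coe_add, Pi.add_apply]
    linear_combination (-2 * h (x i)) * h4
  rw [add_sub_cancel_left, krrObjective, krrObjective, hsum, norm_add_sq_real, hin]
  field_simp
  ring

/-- For `n ≥ 1` and `λ > 0` the criterion has exactly one minimizer. -/
lemma isMinOn_krrObjective_iff {n : ℕ} {lam : ℝ} (hn : 1 ≤ n) (hlam : 0 < lam)
    (x : Fin n → X) (y : Fin n → ℝ) (v : H) :
    IsMinOn (krrObjective lam x y) Set.univ v ↔ v = representer H lam x y := by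
  constructor
  · intro h
    have h1 := h (Set.mem_univ (representer H lam x y))
    simp only [Set.mem_ofPred_eq] at h1
    rw [krrObjective_eq hn hlam x y v] at h1
    have h2 : 0 ≤ (1 / (n : ℝ)) * ∑ i, ((v - representer H lam x y : H) (x i)) ^ 2 := by
      positivity
    have h3 : ‖v - representer H lam x y‖ ^ 2 ≤ 0 := by
      by_contra! h4
      nlinarith [mul_pos hlam h4]
    have h5 : ‖v - representer H lam x y‖ = 0 := by
      nlinarith [norm_nonneg (v - representer H lam x y)]
    exact sub_eq_zero.1 (norm_eq_zero.1 h5)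
  · rintro rfl w -
    simp only [Set.mem_ofPred_eq]
    rw [krrObjective_eq hn hlam x y w]
    have : 0 ≤ (1 / (n : ℝ)) * ∑ i, ((w - representer H lam x y : H) (x i)) ^ 2 +
        lam * ‖w - representer H lam x y‖ ^ 2 := by positivity
    linarith

lemma isMinOn_krr {n : ℕ} {lam : ℝ} (hn : 1 ≤ n) (hlam : 0 < lam)
    (x : Fin n → X) (y : Fin n → ℝ) :
    IsMinOn (krrObjective lam x y) Set.univ (krr H lam x y) :=
  Classical.epsilon_spec (p := fun v : H => IsMinOn (krrObjective lam x y) Set.univ v)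
    ⟨_, (isMinOn_krrObjective_iff hn hlam x y _).2 rfl⟩

lemma krr_eq_representer {n : ℕ} {lam : ℝ} (hn : 1 ≤ n) (hlam : 0 < lam)
    (x : Fin n → X) (y : Fin n → ℝ) : krr H lam x y = representer H lam x y :=
  (isMinOn_krrObjective_iff hn hlam x y _).1 (isMinOn_krr hn hlam x y)

/-- The integrand in the definition of the bias is integrable for integrable errors. -/
lemma integrable_bias {S : Type*} [MeasurableSpace S] {P : Measure S} [IsProbabilityMeasure P]
    {n : ℕ} {lam : ℝ} (hn : 1 ≤ n) (hlam : 0 < lam) (x : Fin n → X) {e : Fin n → S → ℝ}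
    (he : ∀ i, Integrable (e i) P) (f g : H) :
    Integrable (fun ω => ⟪krr H lam x (fun i => f (x i) + e i ω) - f, g⟫_ℝ) P := by
  simp only [krr_eq_representer hn hlam, representer, inner_sub_left, sum_inner, inner_smul_left,
    Matrix.mulVec, dotProduct, conj_trivial]
  refine Integrable.sub (integrable_finsetSum _ fun i _ => Integrable.mul_const ?_ _)
    (integrable_const _)
  refine integrable_finsetSum _ fun j _ => Integrable.const_mul ?_ _
  exact (integrable_const _).add (he j)

end KRR

end KRRBias

end

namespace KRRBias

/-! ### The `L₂` norm -/

/-! The estimator is linear in the data, so the mean-zero errors drop out and the bias is `⟪h, g⟫`,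
where `h` is the error for noiseless data. Minimality gives the energy identity `‖h‖ₙ² + λ‖h‖² =
-λ⟪f, h⟫` (`sq_empNorm_add_eq`). Cauchy–Schwarz on the right would only yield `O(λ^(δ/2))`.

The little-o comes from density: the elements of `H` whose functional is bounded in the `L₂` norm
are dense (`l2BoundedFunctionals_topologicalClosure`). Choose such an `f₀` with `‖f - f₀‖ ≤ η`, so
that `-⟪f, h⟫ ≤ η‖h‖ + C₀‖h‖_{L₂}`. On a good design `n^(-m/d) ≤ c√λ` bounds `‖h‖_{L₂}` by `B Q`,
where `Q²` is the left side of the energy identity and `B = C₁ + Cε c`; hence `Q ≤ √λ (η + C₀ B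
√λ)`. Interpolation through `g` turns this into a bias of at most `λ^(δ/2)` times a constant times
`η + C₀ B √λ` (`abs_inner_representer_sub_le`). Here `η` is arbitrary and `λ → 0`. The bound is
uniform over good designs, so probability enters only through the design condition. -/

/-- The Cauchy–Schwarz inequality for integrals of real functions. -/
lemma sq_integral_mul_le {α : Type*} [MeasurableSpace α] {μ : Measure α} {u v : α → ℝ}
    (huu : Integrable (fun x => u x ^ 2) μ) (hvv : Integrable (fun x => v x ^ 2) μ)
    (huv : Integrable (fun x => u x * v x) μ) :
    (∫ x, u x * v x ∂μ) ^ 2 ≤ (∫ x, u x ^ 2 ∂μ) * ∫ x, v x ^ 2 ∂μ := by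
  -- This quadratic in `t` is the integral of `(t u + v)²`, so its discriminant is nonpositive.
  have h : ∀ t : ℝ, 0 ≤ (∫ x, u x ^ 2 ∂μ) * (t * t) + (2 * ∫ x, u x * v x ∂μ) * t +
      ∫ x, v x ^ 2 ∂μ := by
    intro t
    have h1 : ∫ x, (t * u x + v x) ^ 2 ∂μ = (∫ x, u x ^ 2 ∂μ) * (t * t) +
        (2 * ∫ x, u x * v x ∂μ) * t + ∫ x, v x ^ 2 ∂μ := by
      have h2 : ∀ x, (t * u x + v x) ^ 2 =
          (t * t) * u x ^ 2 + (2 * t) * (u x * v x) + v x ^ 2 := fun x => by ring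
      simp only [h2]
      have h3 : Integrable (fun x => (t * t) * u x ^ 2 + (2 * t) * (u x * v x)) μ :=
        (huu.const_mul _).add (huv.const_mul _)
      rw [integral_add h3 hvv, integral_add (huu.const_mul _) (huv.const_mul _),
        integral_const_mul, integral_const_mul]
      ring
    rw [← h1]
    exact integral_nonneg fun x => sq_nonneg _
  have h3 := discrim_le_zero h
  rw [discrim] at h3
  linarith

section ZeroExt

variable {d : ℕ} {Ω : Set (EuclideanSpace ℝ (Fin d))}

lemma zeroExt_apply (v : Ω → ℝ) (x : Ω) : zeroExt v x = v x :=
  Subtype.val_injective.extend_apply _ _ _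

lemma continuousOn_zeroExt {v : Ω → ℝ} (hv : Continuous v) : ContinuousOn (zeroExt v) Ω := by
  rw [continuousOn_iff_continuous_domRestrict]
  convert hv using 1
  ext x
  exact zeroExt_apply v x

lemma integrable_zeroExt_mul (hΩ : IsCompact Ω) {v w : Ω → ℝ} (hv : Continuous v)
    (hw : Continuous w) :
    Integrable (fun x => zeroExt v x * zeroExt w x) (volume.restrict Ω) :=
  ((continuousOn_zeroExt hv).mul (continuousOn_zeroExt hw)).integrableOn_compact hΩ

lemma integrable_zeroExt_sq (hΩ : IsCompact Ω) {v : Ω → ℝ} (hv : Continuous v) :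
    Integrable (fun x => zeroExt v x ^ 2) (volume.restrict Ω) :=
  ((continuousOn_zeroExt hv).pow 2).integrableOn_compact hΩ

lemma abs_integral_zeroExt_mul_le (hΩ : IsCompact Ω) {v w : Ω → ℝ} (hv : Continuous v)
    (hw : Continuous w) :
    |∫ x in Ω, zeroExt v x * zeroExt w x| ≤ l2Norm v * l2Norm w := by
  rw [l2Norm, l2Norm, ← Real.sqrt_mul (integral_nonneg fun x => sq_nonneg _)]
  exact Real.abs_le_sqrt (sq_integral_mul_le (integrable_zeroExt_sq hΩ hv)
    (integrable_zeroExt_sq hΩ hw) (integrable_zeroExt_mul hΩ hv hw))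

/-- On a convex body, a continuous function of vanishing `L₂` norm vanishes. -/
lemma eq_zero_of_integral_sq_eq_zero (hconv : Convex ℝ Ω) (hcomp : IsCompact Ω)
    (hint : (interior Ω).Nonempty) {v : Ω → ℝ} (hv : Continuous v)
    (h : ∫ x in Ω, zeroExt v x ^ 2 = 0) : v = 0 := by
  have hcont := continuousOn_zeroExt hv
  rw [integral_eq_zero_iff_of_nonneg (fun x => sq_nonneg _) (integrable_zeroExt_sq hcomp hv)] at h
  have h1 : zeroExt v =ᵐ[volume.restrict (interior Ω)] (fun _ => 0) := by
    filter_upwards [ae_restrict_of_ae_restrict_of_subset interior_subset h] with x hx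
    simpa using hx
  have h2 : Set.EqOn (zeroExt v) (fun _ => 0) (interior Ω) :=
    Measure.eqOn_open_of_ae_eq h1 isOpen_interior (hcont.mono interior_subset) continuousOn_const
  -- Convexity makes the interior dense in `Ω`, so vanishing extends by continuity up to the
  -- boundary.
  have h3 : Set.EqOn (zeroExt v) (fun _ => 0) Ω :=
    h2.of_subset_closure hcont continuousOn_const interior_subset
      (by rw [hconv.closure_interior_eq_closure_of_nonempty_interior hint]; exact subset_closure)
  ext x
  rw [← zeroExt_apply v x]
  exact h3 x.2

end ZeroExt

/-! ### Density of the functionals that are bounded in the `L₂` norm -/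

section Density

variable {d : ℕ} {Ω : Set (EuclideanSpace ℝ (Fin d))} {H : Type*} [NormedAddCommGroup H]
  [InnerProductSpace ℝ H] [RKHS ℝ H Ω ℝ]

/-- The elements of `H` whose inner product with `v` is bounded by a multiple of `‖v‖_{L₂}`. -/
def l2BoundedFunctionals (H : Type*) [NormedAddCommGroup H] [InnerProductSpace ℝ H]
    [RKHS ℝ H Ω ℝ] : Submodule ℝ H where
  carrier := {w | ∃ C : ℝ, 0 ≤ C ∧ ∀ v : H, |⟪w, v⟫_ℝ| ≤ C * l2Norm (v : Ω → ℝ)}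
  zero_mem' := ⟨0, le_rfl, fun v => by simp⟩
  add_mem' := by
    rintro a b ⟨C, hC, ha⟩ ⟨D, hD, hb⟩
    refine ⟨C + D, add_nonneg hC hD, fun v => ?_⟩
    rw [inner_add_left, add_mul]
    exact (abs_add_le _ _).trans (add_le_add (ha v) (hb v))
  smul_mem' := by
    rintro c a ⟨C, hC, ha⟩
    refine ⟨|c| * C, by positivity, fun v => ?_⟩
    rw [real_inner_smul_left, abs_mul, mul_assoc]
    exact mul_le_mul_of_nonneg_left (ha v) (abs_nonneg c)

/-- A Hilbert space of continuous functions on a compact set with continuous point evaluations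
embeds continuously into the space of bounded functions. -/
lemma exists_forall_abs_apply_le [CompleteSpace H] (hcomp : IsCompact Ω)
    (hcont : ∀ v : H, Continuous (v : Ω → ℝ)) :
    ∃ C : ℝ, ∀ (v : H) (x : Ω), |v x| ≤ C * ‖v‖ := by
  have : CompactSpace Ω := isCompact_iff_compactSpace.1 hcomp
  -- The family is that of point evaluations, pointwise bounded because each `v` is continuous on a
  -- compact space.
  obtain ⟨C, hC⟩ := banach_steinhaus
    (g := fun x : Ω => (ContinuousLinearMap.proj x).comp (RKHS.coeCLM ℝ : H →L[ℝ] Ω → ℝ))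
    (fun v => by
      obtain ⟨C, hC⟩ := isCompact_univ.exists_bound_of_continuousOn (hcont v).continuousOn
      exact ⟨C, fun x => hC x (Set.mem_univ x)⟩)
  refine ⟨C, fun v x => ?_⟩
  exact (ContinuousLinearMap.le_opNorm _ v).trans
    (mul_le_mul_of_nonneg_right (hC x) (norm_nonneg v))

lemma exists_l2Norm_le [CompleteSpace H] (hcomp : IsCompact Ω)
    (hcont : ∀ v : H, Continuous (v : Ω → ℝ)) :
    ∃ C : ℝ, 0 ≤ C ∧ ∀ v : H, l2Norm (v : Ω → ℝ) ≤ C * ‖v‖ := by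
  obtain ⟨C, hC⟩ := exists_forall_abs_apply_le hcomp hcont
  refine ⟨√(C ^ 2 * volume.real Ω), Real.sqrt_nonneg _, fun v => ?_⟩
  rw [l2Norm, ← Real.sqrt_sq (norm_nonneg v), ← Real.sqrt_mul (by positivity)]
  refine Real.sqrt_le_sqrt ?_
  have h1 : ∫ x in Ω, zeroExt (v : Ω → ℝ) x ^ 2 ≤ ∫ _ in Ω, (C * ‖v‖) ^ 2 := by
    refine setIntegral_mono_on (integrable_zeroExt_sq hcomp (hcont v))
      (integrableOn_const hcomp.measure_lt_top.ne) hcomp.measurableSet fun x hx => ?_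
    rw [zeroExt_apply (v : Ω → ℝ) ⟨x, hx⟩]
    exact sq_le_sq' (abs_le.1 (hC v ⟨x, hx⟩)).1 (abs_le.1 (hC v ⟨x, hx⟩)).2
  refine h1.trans (le_of_eq ?_)
  rw [setIntegral_const, smul_eq_mul]
  ring

/-- The `L₂` inner product with an element of `H` is a bounded functional on `H`. -/
lemma exists_inner_eq_integral [CompleteSpace H] (hcomp : IsCompact Ω)
    (hcont : ∀ v : H, Continuous (v : Ω → ℝ)) (w : H) :
    ∃ a : H, ∀ v : H, ⟪a, v⟫_ℝ = ∫ x in Ω, zeroExt (w : Ω → ℝ) x * zeroExt (v : Ω → ℝ) x := by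
  obtain ⟨C, -, hC⟩ := exists_l2Norm_le hcomp hcont
  let L : H →ₗ[ℝ] ℝ :=
    { toFun := fun v => ∫ x in Ω, zeroExt (w : Ω → ℝ) x * zeroExt (v : Ω → ℝ) x
      map_add' := fun u v => by
        rw [← integral_add (integrable_zeroExt_mul hcomp (hcont w) (hcont u))
          (integrable_zeroExt_mul hcomp (hcont w) (hcont v))]
        refine setIntegral_congr_fun hcomp.measurableSet fun x hx => ?_
        lift x to Ω using hx
        simp only [zeroExt_apply, RKHS.coe_add, Pi.add_apply, mul_add]
      map_smul' := fun c v => by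
        rw [RingHom.id_apply, smul_eq_mul, ← integral_const_mul]
        refine setIntegral_congr_fun hcomp.measurableSet fun x hx => ?_
        lift x to Ω using hx
        simp only [zeroExt_apply, RKHS.coe_smul, Pi.smul_apply, smul_eq_mul]
        ring }
  have hL : ∀ v, ‖L v‖ ≤ (l2Norm (w : Ω → ℝ) * C) * ‖v‖ := fun v => by
    refine (abs_integral_zeroExt_mul_le hcomp (hcont w) (hcont v)).trans ?_
    rw [mul_assoc]
    exact mul_le_mul_of_nonneg_left (hC v) (Real.sqrt_nonneg _)
  refine ⟨(InnerProductSpace.toDual ℝ H).symm (L.mkContinuous _ hL), fun v => ?_⟩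
  rw [InnerProductSpace.toDual_symm_apply]
  rfl

/-- If `w` is orthogonal to the subspace, test it against the Riesz representer `a` of `v ↦ ∫ w v`,
which lies in the subspace by Cauchy–Schwarz. This gives `∫ w² = 0`, hence `w = 0`. -/
lemma l2BoundedFunctionals_topologicalClosure [CompleteSpace H] (hconv : Convex ℝ Ω)
    (hcomp : IsCompact Ω) (hint : (interior Ω).Nonempty)
    (hcont : ∀ v : H, Continuous (v : Ω → ℝ)) :
    (l2BoundedFunctionals H).topologicalClosure = ⊤ := by
  rw [Submodule.topologicalClosure_eq_top_iff, Submodule.eq_bot_iff]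
  intro w hw
  obtain ⟨a, ha⟩ := exists_inner_eq_integral hcomp hcont w
  have hmem : a ∈ l2BoundedFunctionals H :=
    ⟨l2Norm (w : Ω → ℝ), Real.sqrt_nonneg _, fun v => by
      rw [ha]; exact abs_integral_zeroExt_mul_le hcomp (hcont w) (hcont v)⟩
  have h := (Submodule.mem_orthogonal _ _).1 hw a hmem
  rw [ha] at h
  simp only [← sq] at h
  refine DFunLike.coe_injective ?_
  rw [RKHS.coe_zero]
  exact eq_zero_of_integral_sq_eq_zero hconv hcomp hint (hcont w) h

end Density

/-! ### The bias of kernel ridge regression -/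

section Bias

variable {X H : Type*} [NormedAddCommGroup H] [InnerProductSpace ℝ H] [RKHS ℝ H X ℝ]

lemma sq_empNorm {n : ℕ} (x : Fin n → X) (v : X → ℝ) :
    empNorm x v ^ 2 = (1 / (n : ℝ)) * ∑ i, v (x i) ^ 2 :=
  Real.sq_sqrt (by positivity)

variable [CompleteSpace H]

lemma representer_add {n : ℕ} (lam : ℝ) (x : Fin n → X) (y z : Fin n → ℝ) :
    representer H lam x (y + z) = representer H lam x y + representer H lam x z := by
  simp only [representer, Matrix.mulVec_add, Pi.add_apply, add_smul, Finset.sum_add_distrib]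

/-- The bias is the error of the estimator for noiseless data. -/
lemma bias_eq {S : Type*} [MeasurableSpace S] {P : Measure S} [IsProbabilityMeasure P]
    {n : ℕ} {lam : ℝ} (hn : 1 ≤ n) (hlam : 0 < lam) (x : Fin n → X) {e : Fin n → S → ℝ}
    (he : ∀ i, Integrable (e i) P) (hmean : ∀ i, ∫ ω, e i ω ∂P = 0) (f g : H) :
    bias P lam x e f g = ⟪representer H lam x (fun i => f (x i)) - f, g⟫_ℝ := by
  have h1 : ∀ ω, ⟪krr H lam x (fun i => f (x i) + e i ω) - f, g⟫_ℝ =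
      ⟪representer H lam x (fun i => f (x i)) - f, g⟫_ℝ +
        ⟪representer H lam x (fun i => e i ω), g⟫_ℝ := by
    intro ω
    rw [krr_eq_representer hn hlam, ← inner_add_left]
    congr 1
    rw [show (fun i => f (x i) + e i ω) = (fun i => f (x i)) + fun i => e i ω from rfl,
      representer_add]
    abel
  -- With the design fixed, the noise contribution is a linear form in the errors with deterministic
  -- coefficients, so its mean is zero.
  have h2 : ∃ M : Fin n → Fin n → ℝ, ∀ ω, ⟪representer H lam x (fun i => e i ω), g⟫_ℝ =
      ∑ i, ∑ j, M i j * e j ω := by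
    refine ⟨fun i j => (kernelMatrix H x + (lam * n) • (1 : Matrix (Fin n) (Fin n) ℝ))⁻¹ i j *
      ⟪RKHS.kerFun H (x i) (1 : ℝ), g⟫_ℝ, fun ω => ?_⟩
    rw [representer, sum_inner]
    refine Finset.sum_congr rfl fun i _ => ?_
    rw [real_inner_smul_left, Matrix.mulVec, dotProduct, Finset.sum_mul]
    exact Finset.sum_congr rfl fun j _ => mul_right_comm _ _ _
  obtain ⟨M, hM⟩ := h2
  have hint : ∀ i j, Integrable (fun ω => M i j * e j ω) P := fun i j => (he j).const_mul _
  have hint' : ∀ i, Integrable (fun ω => ∑ j, M i j * e j ω) P :=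
    fun i => integrable_finsetSum _ fun j _ => hint i j
  have h3 : ∫ ω, ∑ i, ∑ j, M i j * e j ω ∂P = 0 := by
    rw [integral_finsetSum _ fun i _ => hint' i]
    refine Finset.sum_eq_zero fun i _ => ?_
    rw [integral_finsetSum _ fun j _ => hint i j]
    simp [integral_const_mul, hmean]
  simp only [bias, h1, hM]
  rw [integral_add (integrable_const _) (integrable_finsetSum _ fun i _ => hint' i), h3]
  simp

/-- The energy identity for the error `h` of the estimator for noiseless data. -/
lemma sq_empNorm_add_eq {n : ℕ} {lam : ℝ} (hn : 1 ≤ n) (hlam : 0 < lam) (x : Fin n → X) (f : H) :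
    empNorm x (representer H lam x (fun i => f (x i)) - f : H) ^ 2 +
        lam * ‖representer H lam x (fun i => f (x i)) - f‖ ^ 2 =
      -(lam * ⟪f, representer H lam x (fun i => f (x i)) - f⟫_ℝ) := by
  -- The expansion around the minimizer is evaluated at `f` itself, which fits the noiseless data
  -- exactly.
  have h := krrObjective_eq hn hlam x (fun i => f (x i)) f
  set r := representer H lam x (fun i => f (x i))
  have h1 : ‖r‖ ^ 2 = ‖f‖ ^ 2 + 2 * ⟪f, r - f⟫_ℝ + ‖r - f‖ ^ 2 := by
    rw [← norm_add_sq_real, add_sub_cancel]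
  have h2 : ∑ i, ((f - r : H) (x i)) ^ 2 = ∑ i, ((r - f : H) (x i)) ^ 2 := by
    simp only [RKHS.coe_sub, Pi.sub_apply]
    exact Finset.sum_congr rfl fun i _ => by ring
  have h3 : ∑ i, (f (x i) - r (x i)) ^ 2 = ∑ i, ((r - f : H) (x i)) ^ 2 := by
    simp only [RKHS.coe_sub, Pi.sub_apply]
    exact Finset.sum_congr rfl fun i _ => by ring
  rw [norm_sub_rev f r] at h
  simp only [krrObjective, h2, h3, sub_self] at h
  rw [sq_empNorm]
  simp only [ne_eq, OfNat.ofNat_ne_zero, not_false_eq_true, zero_pow, Finset.sum_const_zero,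
    mul_zero, zero_add, h1] at h
  linarith

end Bias

/-! ### The bias rate on good designs -/

section Rate

variable {d : ℕ} {Ω : Set (EuclideanSpace ℝ (Fin d))} {H : Type*} [NormedAddCommGroup H]
  [InnerProductSpace ℝ H] [RKHS ℝ H Ω ℝ] [CompleteSpace H]

/-- The error of the estimator for noiseless data on a good design, if `f` is at distance `η` from
an element `f₀` with `⟨f₀, v⟩ ≤ C₀ ‖v‖_{L₂}`. -/
lemma abs_inner_representer_sub_le {m C₁ Cε c C₀ Cg δ η lam : ℝ} {n : ℕ} (hn : 1 ≤ n)
    (hlam : 0 < lam) (hC₁ : 0 < C₁) (hCε : 0 < Cε) (hc : 0 ≤ c) (hC₀ : 0 ≤ C₀) (hCg : 0 < Cg)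
    (hδ : δ ∈ Set.Ioc (0 : ℝ) 1) (hη : 0 ≤ η) {x : Fin n → Ω}
    (hx : x ∈ goodDesigns H m C₁ Cε n) (hrate : (n : ℝ) ^ (-(m / d)) ≤ c * √lam) {f f₀ g : H}
    (hf₀ : ∀ v : H, |⟪f₀, v⟫_ℝ| ≤ C₀ * l2Norm (v : Ω → ℝ)) (hff₀ : ‖f - f₀‖ ≤ η)
    (hg : ∀ v : H, |⟪g, v⟫_ℝ| ≤ Cg * l2Norm (v : Ω → ℝ) ^ δ * ‖v‖ ^ (1 - δ)) :
    |⟪representer H lam x (fun i => f (x i)) - f, g⟫_ℝ| / lam ^ (δ / 2) ≤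
      Cg * (C₁ + Cε * c) ^ δ * (η + C₀ * (C₁ + Cε * c) * √lam) := by
  have henergy := sq_empNorm_add_eq hn hlam x f
  set h : H := representer H lam x (fun i => f (x i)) - f
  set s := √lam with hs
  have hs0 : 0 < s := Real.sqrt_pos.2 hlam
  have hs2 : lam = s ^ 2 := (Real.sq_sqrt hlam.le).symm
  set N := empNorm x (h : Ω → ℝ)
  have hN : 0 ≤ N := Real.sqrt_nonneg _
  set B := C₁ + Cε * c
  have hB : 0 ≤ B := by positivity
  -- `Q` is the square root of the energy; it dominates both `‖h‖ₙ` and `√λ ‖h‖`, hence also the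
  -- `L₂` norm up to the factor `B`.
  set Q := √(N ^ 2 + (s * ‖h‖) ^ 2)
  have hQ0 : 0 ≤ Q := Real.sqrt_nonneg _
  have hQsq : Q ^ 2 = N ^ 2 + (s * ‖h‖) ^ 2 := Real.sq_sqrt (by positivity)
  have hNQ : N ≤ Q := Real.le_sqrt_of_sq_le (by nlinarith [sq_nonneg (s * ‖h‖)])
  have hhQ : s * ‖h‖ ≤ Q := Real.le_sqrt_of_sq_le (by nlinarith [sq_nonneg N])
  have hl2 : l2Norm (h : Ω → ℝ) ≤ B * Q := by
    refine (hx h).1.trans (max_le ?_ ?_)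
    · exact mul_le_mul (le_add_of_nonneg_right (by positivity)) hNQ hN hB
    · calc Cε * (n : ℝ) ^ (-(m / d)) * ‖h‖ ≤ Cε * (c * s) * ‖h‖ := by gcongr
        _ = (Cε * c) * (s * ‖h‖) := by ring
        _ ≤ B * Q := mul_le_mul (le_add_of_nonneg_left hC₁.le) hhQ (by positivity) hB
  have hl20 : 0 ≤ l2Norm (h : Ω → ℝ) := Real.sqrt_nonneg _
  have hinner : -⟪f, h⟫_ℝ ≤ η * ‖h‖ + C₀ * l2Norm (h : Ω → ℝ) := by
    have h1 : ⟪f, h⟫_ℝ = ⟪f - f₀, h⟫_ℝ + ⟪f₀, h⟫_ℝ := by rw [← inner_add_left, sub_add_cancel]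
    have h2 := (abs_real_inner_le_norm (f - f₀) h).trans
      (mul_le_mul_of_nonneg_right hff₀ (norm_nonneg h))
    linarith [(abs_le.1 h2).1, (abs_le.1 (hf₀ h)).1]
  have hQle : Q ≤ s * (η + C₀ * B * s) := by
    have h1 : Q * Q ≤ Q * (s * (η + C₀ * B * s)) := by
      calc Q * Q = lam * -⟪f, h⟫_ℝ := by rw [← sq, hQsq, mul_pow, ← hs2, henergy]; ring
        _ ≤ s ^ 2 * (η * ‖h‖ + C₀ * (B * Q)) := by
          rw [hs2]
          exact mul_le_mul_of_nonneg_left (hinner.trans (by gcongr)) (sq_nonneg s)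
        _ = s * η * (s * ‖h‖) + C₀ * B * s ^ 2 * Q := by ring
        _ ≤ s * η * Q + C₀ * B * s ^ 2 * Q := by gcongr
        _ = Q * (s * (η + C₀ * B * s)) := by ring
    rcases hQ0.eq_or_lt with hQ | hQ
    · rw [← hQ]; positivity
    · exact le_of_mul_le_mul_left h1 hQ
  set t := η + C₀ * B * s
  have ht : 0 ≤ t := by positivity
  have hht : ‖h‖ ≤ t := le_of_mul_le_mul_left (hhQ.trans hQle) hs0
  have hl2t : l2Norm (h : Ω → ℝ) ≤ B * (s * t) := hl2.trans (mul_le_mul_of_nonneg_left hQle hB)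
  have hsd : lam ^ (δ / 2) = s ^ δ := by
    rw [hs, Real.sqrt_eq_rpow, ← Real.rpow_mul hlam.le]; congr 1; ring
  -- The additivity of exponents has to allow `t = 0`; both exponents are nonnegative.
  have htt : t ^ δ * t ^ (1 - δ) = t := by
    rw [← Real.rpow_add_of_nonneg ht hδ.1.le (sub_nonneg.2 hδ.2)]; simp
  rw [div_le_iff₀ (by positivity), real_inner_comm, hsd]
  calc |⟪g, h⟫_ℝ| ≤ Cg * l2Norm (h : Ω → ℝ) ^ δ * ‖h‖ ^ (1 - δ) := hg h
    _ ≤ Cg * (B * (s * t)) ^ δ * t ^ (1 - δ) := by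
      have h1 := Real.rpow_le_rpow hl20 hl2t hδ.1.le
      have h2 := Real.rpow_le_rpow (norm_nonneg h) hht (sub_nonneg.2 hδ.2)
      gcongr
    _ = Cg * B ^ δ * (t ^ δ * t ^ (1 - δ)) * s ^ δ := by
      rw [Real.mul_rpow hB (by positivity), Real.mul_rpow hs0.le ht]; ring
    _ = Cg * B ^ δ * t * s ^ δ := by rw [htt]

/-- On good designs the error of the estimator for noiseless data is eventually uniformly small
compared to `λ ^ (δ / 2)`. -/
lemma eventually_abs_inner_representer_sub_lt (hconv : Convex ℝ Ω) (hcomp : IsCompact Ω)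
    (hint : (interior Ω).Nonempty) (hcont : ∀ v : H, Continuous (v : Ω → ℝ)) {m δ C₁ Cε : ℝ}
    (hδ : δ ∈ Set.Ioc (0 : ℝ) 1) {g : H} (hg : HasExtraSmoothness δ g) (f : H)
    {lam : ℕ → ℝ} (hlam_pos : ∀ n, 1 ≤ n → 0 < lam n)
    (hlam_lower : (fun n : ℕ => (n : ℝ) ^ (-(2 * m / d))) =O[atTop] lam)
    (hlam_zero : Tendsto lam atTop (𝓝 0)) (hC₁ : 0 < C₁) (hCε : 0 < Cε) {r : ℝ} (hr : 0 < r) :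
    ∀ᶠ n in atTop, ∀ x ∈ goodDesigns (Ω := Ω) H m C₁ Cε n,
      |⟪representer H (lam n) x (fun i => f (x i)) - f, g⟫_ℝ| / lam n ^ (δ / 2) < r := by
  obtain ⟨Cg, hCg, hg⟩ := hg
  obtain ⟨c, hc, hrate⟩ := hlam_lower.exists_nonneg
  -- The root appears because `c` bounds `n^(-2m/d)` by `cλ`, while the design condition involves
  -- `n^(-m/d)`.
  set B := C₁ + Cε * √c
  have hB : 0 < B := by positivity
  set A := Cg * B ^ δ
  have hA : 0 < A := by positivity
  have hdense : f ∈ closure (l2BoundedFunctionals H : Set H) := by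
    rw [← Submodule.topologicalClosure_coe,
      l2BoundedFunctionals_topologicalClosure hconv hcomp hint hcont]
    trivial
  -- The distance `r / (2A)` makes the limiting bound `r / 2`, strictly below `r`; `C₀` may be
  -- large, but it is multiplied by `√λ → 0`.
  obtain ⟨f₀, ⟨C₀, hC₀, hf₀⟩, hff₀⟩ := Metric.mem_closure_iff.1 hdense (r / (2 * A)) (by positivity)
  have hlim : Tendsto (fun n => A * (r / (2 * A) + C₀ * B * √(lam n))) atTop (𝓝 (r / 2)) := by
    have h1 : Tendsto (fun n => √(lam n)) atTop (𝓝 0) := by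
      simpa [Function.comp_def] using (Real.continuous_sqrt.tendsto 0).comp hlam_zero
    have h2 := ((h1.const_mul (C₀ * B)).const_add (r / (2 * A))).const_mul A
    convert h2 using 2
    field_simp
    ring
  filter_upwards [hrate.bound, eventually_ge_atTop 1, hlim.eventually_lt_const (half_lt_self hr)]
    with n hn hn1 hlt x hx
  refine lt_of_le_of_lt (abs_inner_representer_sub_le hn1 (hlam_pos n hn1) hC₁ hCε
    (Real.sqrt_nonneg c) hC₀ hCg hδ (by positivity) hx ?_ hf₀ ?_ hg) hlt
  · rw [Real.norm_of_nonneg (by positivity), Real.norm_of_nonneg (hlam_pos n hn1).le] at hn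
    rw [← Real.sqrt_mul hc]
    refine Real.le_sqrt_of_sq_le (le_of_eq_of_le ?_ hn)
    rw [← Real.rpow_natCast, ← Real.rpow_mul (Nat.cast_nonneg n)]
    congr 1
    push_cast
    ring
  · rw [← dist_eq_norm]
    exact hff₀.le

end Rate

end KRRBias

/-! ### Convergence in probability -/

theorem mainTheorem11
    {d : ℕ} (hd : 0 < d)
    {Ω : Set (EuclideanSpace ℝ (Fin d))}
    (hΩconv : Convex ℝ Ω) (hΩcomp : IsCompact Ω) (hΩint : (interior Ω).Nonempty)
    {m : ℝ} (hm : (d : ℝ) / 2 < m)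
    {H : Type*} [NormedAddCommGroup H] [InnerProductSpace ℝ H] [CompleteSpace H]
    [RKHS ℝ H Ω ℝ] (hH : KRRBias.IsSobolevRKHS m Ω H)
    {δ : ℝ} (hδ : δ ∈ Set.Ioc (0 : ℝ) 1)
    {g : H} (hg : KRRBias.HasExtraSmoothness δ g)
    (f : H)
    {S : Type*} [MeasurableSpace S] {P : Measure S} [IsProbabilityMeasure P]
    {X : (n : ℕ) → Fin n → S → Ω} (hX : ∀ n i, Measurable (X n i))
    {e : (n : ℕ) → Fin n → S → ℝ}
    (he_sq : ∀ n i, MemLp (e n i) 2 P)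
    (he_mean : ∀ n i, ∫ ω, e n i ω ∂P = 0)
    (he_indep : ∀ n, iIndepFun (e n) P)
    (he_ident : ∀ n i j, IdentDistrib (e n i) (e n j) P P)
    (hXe : ∀ n, IndepFun (fun ω i => X n i ω) (fun ω i => e n i ω) P)
    (hdesign : KRRBias.DesignCondition H m P X)
    {lam : ℕ → ℝ} (hlam_pos : ∀ n, 1 ≤ n → 0 < lam n)
    (hlam_lower : (fun n : ℕ => (n : ℝ) ^ (-(2 * m / d))) =O[atTop] lam)
    (hlam_zero : Tendsto lam atTop (𝓝 0)) :
    TendstoInMeasure P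
      (fun n ω => |KRRBias.bias P (lam n) (fun i => X n i ω) (e n) f g| / lam n ^ (δ / 2))
      atTop (fun _ => 0) := by
  rw [tendstoInMeasure_iff_norm]
  intro r hr
  rw [ENNReal.tendsto_atTop_zero]
  intro ε hε
  obtain ⟨ε', hε', hεε'⟩ : ∃ ε' : ℝ, 0 < ε' ∧ ENNReal.ofReal ε' ≤ ε := by
    rcases eq_or_ne ε ⊤ with rfl | htop
    · exact ⟨1, one_pos, le_top⟩
    · exact ⟨ε.toReal, ENNReal.toReal_pos hε.ne' htop, ENNReal.ofReal_toReal_le⟩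
  obtain ⟨C₁, hC₁, hdes⟩ := hdesign
  obtain ⟨Cε, hCε, hdes⟩ := hdes ε' hε'
  obtain ⟨N, hN⟩ := eventually_atTop.1 (KRRBias.eventually_abs_inner_representer_sub_lt hΩconv
    hΩcomp hΩint hH.continuous hδ hg f hlam_pos hlam_lower hlam_zero hC₁ hCε hr)
  refine ⟨max N 1, fun n hn => ?_⟩
  have hn1 : 1 ≤ n := (le_max_right _ _).trans hn
  -- A large bias is impossible on a good design, so that event lies inside the bad-design event, of
  -- probability at most `ε'`.
  refine ((measure_mono fun ω hω hgood => ?_).trans (hdes n hn1)).trans hεε'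
  have hlt := hN n ((le_max_left _ _).trans hn) _ hgood
  -- The bias integrates over the errors with the design frozen at its value for `ω`, so the
  -- identity applies for each `ω` separately.
  rw [← KRRBias.bias_eq hn1 (hlam_pos n hn1) (fun i => X n i ω)
    (fun i => (he_sq n i).integrable one_le_two) (he_mean n) f g] at hlt
  have hpos := Real.rpow_nonneg (hlam_pos n hn1).le (δ / 2)
  rw [Set.mem_ofPred_eq, sub_zero, Real.norm_of_nonneg (by positivity)] at hω
  exact absurd hlt (not_lt.2 hω)
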